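/- Let $J$ be a $k$-element subset of $[n]=\{1,\dots,n\}$, with $J=\{j_1<\dots<j_k\}$ and $[n]\setminus J=\{h_1<\dots<h_{n-k}\}$. Let $$S_J=\{\pi\in S_n : \pi(j)\ge j \text{ for } j\in J,\ \pi(j)\le j \text{ for } j\notin J\},\qquad \mathrm{Br}_J=\mathrm{conv}\{(\pi(1),\dots,\pi(n)) : \pi\in S_J\}\subset\mathbb{R}^n,$$ and let $\pi(J)\in S_J$ be the permutation with $\pi(J)(h_i)=i$ for $1\le i\le n-k$ and $\pi(J)(j_i)=n-k+i$ for $1\le i\le k$. The vertices of $\mathrm{Br}_J$ are exactly the points $(\pi(1),\dots,\pi(n))$ with $\pi\in S_J$; we label each vertex by the corresponding $\pi$, and we label an edge traversed from $\pi$ to $\hat\pi$ by the permutation $\hat\pi\pi^{-1}$ (the transposition of the two values that are swapped). A decorated permutation is a permutation $\sigma\in S_n$ each of whose fixed points is coloured clockwise or counterclockwise. Its affinization $\tilde\sigma:[n]\to\{1,\dots,2n\}$ is given by $\tilde\sigma(i)=\sigma(i)+n$ if $\sigma(i)<i$ or $i$ is a counterclockwise fixed point, and $\tilde\sigma(i)=\sigma(i)$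 otherwise. A position $i$ of a map $f:[n]\to\{1,\dots,2n\}$ is called a fixed point if $f(i)\in\{i,i+n\}$, and $f$ is a decoration of the identity if every position is a fixed point. A BCFW-bridge decomposition of a decorated permutation $\sigma$ is a sequence of transpositions obtained as follows: starting with $f=\tilde\sigma$, and as long as $f$ is not a decoration of the identity, choose positions $i<j$ which are not fixed points of $f$, such that every position $h$ with $i<h<j$ is a fixed point of $f$ and $f(i)<f(j)$; record the transposition $(i\,j)$ and swap the entries of $f$ in positions $i$ and $j$; stop when $f$ is a decoration of the identity. Then the following hold. 1. For any choice of the colours of the fixed points of $\pi(J)^{-1}$, the map that sends a path to its sequence of edge labels is a bijection from the set of shortest paths from $\pi(J)$ to the identity permutation $e$ along the one-skeleton of $\mathrm{Br}_J$ to the set of BCFW-bridge decompositions of $\pi(J)^{-1}$. 2. For $\pi,\hat\pi\in S_J$ there is an edge of $\mathrm{Br}_J$ between the vertices $\pi$ and $\hat\pi$ if and only if there exist $i<\ell$ such that $\hat\pi=(i\,\ell)\pi$ and $\pi(j)=\hat\pi(j)=j$ for all $i<j<\ell$. -/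

import Mathlib

/-! Conventions: the set `[n] = {1, …, n}` is modelled by `Fin n = {0, …, n - 1}`, so positions and
values of permutations are shifted by one. -/

namespace BridgePolytope

/-- The set `S_J` of permutations with a weak excedance in every position of `J` and a weak
non-excedance in every other position. -/
def permSet {n : ℕ} (J : Finset (Fin n)) : Set (Equiv.Perm (Fin n)) :=
  {π | (∀ j ∈ J, j ≤ π j) ∧ (∀ j ∉ J, π j ≤ j)}

/-- The point `(π(1), …, π(n))` of `ℝⁿ` (with values in `{1, …, n}`). -/
def permPoint {n : ℕ} (π : Equiv.Perm (Fin n)) : Fin n → ℝ :=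
  fun j => ((π j : ℕ) : ℝ) + 1

/-- The bridge polytope `Br_J ⊆ ℝⁿ`. -/
def bridgePolytope {n : ℕ} (J : Finset (Fin n)) : Set (Fin n → ℝ) :=
  convexHull ℝ (permPoint '' permSet J)

/-- The one-skeleton of `Br_J`, on the vertices labelled by `S_J`: two vertices are adjacent if they
are distinct and the segment between them is a face of `Br_J`, that is, the set of points of `Br_J`
where some linear functional attains its maximum over `Br_J`. -/
def oneSkeleton {n : ℕ} (J : Finset (Fin n)) : SimpleGraph (permSet J) where
  Adj π ρ := π ≠ ρ ∧
    IsExposed ℝ (bridgePolytope J) (segment ℝ (permPoint π.1) (permPoint ρ.1))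
  symm := ⟨fun _ _ h => ⟨h.1.symm, by rw [segment_symm]; exact h.2⟩⟩
  loopless := ⟨fun _ h => h.1 rfl⟩

/-- The sequence of edge labels along a walk in the one-skeleton. The edge traversed from `π` to `ρ`
is labelled by the permutation `σ` of the values with `σ π = ρ`. -/
def edgeLabels {n : ℕ} {J : Finset (Fin n)} {π ρ : permSet J} (p : (oneSkeleton J).Walk π ρ) :
    List (Equiv.Perm (Fin n)) :=
  p.darts.map fun d => d.snd.1 * (d.fst.1)⁻¹

/-- The permutation `π(J)`: if `J = {j_1 < ⋯ < j_k}` has complement `{h_1 < ⋯ < h_{n-k}}`, then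
`π(h_i) = i` and `π(j_i) = n - k + i`. -/
def schubertPerm {n : ℕ} (J : Finset (Fin n)) : Equiv.Perm (Fin n) :=
  (finSumEquivOfFinset (s := J) (m := J.card) (n := n - J.card) rfl
      (by rw [Finset.card_compl, Fintype.card_fin])).symm.trans
    ((Equiv.sumComm _ _).trans (finSumFinEquiv.trans
      (finCongr (Nat.sub_add_cancel (by simpa using Finset.card_le_univ J)))))

theorem schubertPerm_compl {n : ℕ} (J : Finset (Fin n)) (h : Jᶜ.card = n - J.card)
    (i : Fin (n - J.card)) : (schubertPerm J (Jᶜ.orderEmbOfFin h i) : ℕ) = i := by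
  rw [← finSumEquivOfFinset_inr (s := J) rfl h]
  simp only [schubertPerm, Equiv.trans_apply, Equiv.symm_apply_apply]
  simp

theorem schubertPerm_mem {n : ℕ} (J : Finset (Fin n)) (i : Fin J.card) :
    (schubertPerm J (J.orderEmbOfFin rfl i) : ℕ) = n - J.card + i := by
  rw [← finSumEquivOfFinset_inl (s := J) rfl (by rw [Finset.card_compl, Fintype.card_fin])]
  simp only [schubertPerm, Equiv.trans_apply, Equiv.symm_apply_apply]
  simp

theorem schubertPerm_mem_permSet {n : ℕ} (J : Finset (Fin n)) :
    schubertPerm J ∈ permSet J := by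
  have hk : J.card ≤ n := by simpa using Finset.card_le_univ J
  have hc : Jᶜ.card = n - J.card := by rw [Finset.card_compl, Fintype.card_fin]
  constructor
  · intro j hj
    have hr := Finset.range_orderEmbOfFin J rfl
    obtain ⟨i, rfl⟩ : j ∈ Set.range (J.orderEmbOfFin rfl) := by rw [hr]; exact hj
    rw [Fin.le_def, schubertPerm_mem]
    have hcard : (Finset.Ioi i).card ≤ (Finset.Ioi (J.orderEmbOfFin rfl i)).card :=
      Finset.card_le_card_of_injOn (J.orderEmbOfFin rfl) (by intro a; simp)
        (J.orderEmbOfFin rfl).injective.injOn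
    rw [Fin.card_Ioi, Fin.card_Ioi] at hcard
    have h1 := i.2
    have h2 := (J.orderEmbOfFin rfl i).2
    omega
  · intro j hj
    have hr := Finset.range_orderEmbOfFin Jᶜ hc
    obtain ⟨i, rfl⟩ : j ∈ Set.range (Jᶜ.orderEmbOfFin hc) := by rw [hr]; simpa using hj
    rw [Fin.le_def, schubertPerm_compl]
    have hcard : (Finset.Iio i).card ≤ (Finset.Iio (Jᶜ.orderEmbOfFin hc i)).card :=
      Finset.card_le_card_of_injOn (Jᶜ.orderEmbOfFin hc) (by intro a; simp)
        (Jᶜ.orderEmbOfFin hc).injective.injOn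
    rwa [Fin.card_Iio, Fin.card_Iio] at hcard

theorem one_mem_permSet {n : ℕ} (J : Finset (Fin n)) : (1 : Equiv.Perm (Fin n)) ∈ permSet J :=
  ⟨fun _ _ => le_rfl, fun _ _ => le_rfl⟩

/-- The vertex of `Br_J` labelled by `π(J)`. -/
def topVertex {n : ℕ} (J : Finset (Fin n)) : permSet J := ⟨schubertPerm J, schubertPerm_mem_permSet J⟩

/-- The vertex of `Br_J` labelled by the identity permutation `e`. -/
def idVertex {n : ℕ} (J : Finset (Fin n)) : permSet J := ⟨1, one_mem_permSet J⟩

/-- A decorated permutation: every fixed point has one of two colours, counterclockwise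
(the elements of `ccw`) or clockwise (the other fixed points). -/
structure DecoratedPerm (n : ℕ) where
  perm : Equiv.Perm (Fin n)
  ccw : Finset (Fin n)
  fixed_of_mem_ccw : ∀ i ∈ ccw, perm i = i

/-- The affinization of a decorated permutation, as a list of `n` values. -/
def DecoratedPerm.affinization {n : ℕ} (D : DecoratedPerm n) : Fin n → ℕ :=
  fun i => if D.perm i < i ∨ i ∈ D.ccw then (D.perm i : ℕ) + n else (D.perm i : ℕ)

/-- Position `i` is a fixed point of the affine permutation `f`. -/
def IsFixedPos {n : ℕ} (f : Fin n → ℕ) (i : Fin n) : Prop :=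
  f i = i ∨ f i = i + n

/-- `f` is a decoration of the identity. -/
def IsDecoratedId {n : ℕ} (f : Fin n → ℕ) : Prop :=
  ∀ i, IsFixedPos f i

/-- The positions `i < j` may be swapped in `f`: neither is a fixed point, all positions strictly
between them are fixed points, and `f i < f j`. -/
def IsBridge {n : ℕ} (f : Fin n → ℕ) (i j : Fin n) : Prop :=
  i < j ∧ ¬ IsFixedPos f i ∧ ¬ IsFixedPos f j ∧ (∀ h, i < h → h < j → IsFixedPos f h) ∧ f i < f j

/-- `IsBridgeSequence f τ`: the list `τ` is the sequence of transpositions recorded by some run of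
the BCFW-bridge construction that starts at `f` and ends at a decoration of the identity.
(Fixed points are never moved, so that they are frozen.) -/
inductive IsBridgeSequence {n : ℕ} : (Fin n → ℕ) → List (Equiv.Perm (Fin n)) → Prop
  | done (f : Fin n → ℕ) (hf : IsDecoratedId f) : IsBridgeSequence f []
  | step (f : Fin n → ℕ) (i j : Fin n) (τ : List (Equiv.Perm (Fin n))) (hij : IsBridge f i j)
      (hτ : IsBridgeSequence (f ∘ Equiv.swap i j) τ) :
      IsBridgeSequence f (Equiv.swap i j :: τ)

/-- The list `τ` is a BCFW-bridge decomposition of the decorated permutation `D`. -/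
def IsBridgeDecomposition {n : ℕ} (D : DecoratedPerm n) (τ : List (Equiv.Perm (Fin n))) : Prop :=
  IsBridgeSequence D.affinization τ

end BridgePolytope

/-! Vertices and edges come from linear functionals. By the rearrangement inequality, the functional
with coefficients `π` is maximised over all permutations only at `π`, so every point labelled by
`S_J` is a vertex. If `π` and `(i l)π` fix everything strictly between `i` and `l`, collapse the
coefficients on `[i, l]` to a constant and add a penalty for moving the positions between `i` and
`l`: the maximum over `S_J` is attained at exactly these two points (`isExposed_segment_of_swap`).
Conversely, the displacement from `π` to any `ρ` in `S_J` is a sum of elementary moves, each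
parallel to a swap that stays in `S_J` (`IsDisplacement.exists_move`). A functional exposing the
segment from `π` to `ρ` is nonpositive on all moves and zero on their sum, so it vanishes on the
first one. The swapped permutation is then a vertex on the segment, hence equal to `ρ`. For the
paths, lift `π⁻¹` to an affine permutation. Its length changes by exactly one along each edge
(`affineLength_comp_swap`), and the bridges are precisely the edges that increase it. A bridge
exists whenever `π ≠ 1`, so some increasing path reaches `e`. Shortest paths are therefore the
increasing ones, that is, the bridge decompositions. The colours of fixed points play no role,
because increasing edges never touch fixed points. -/

namespace BridgePolytope

section

open Finset

/-! ### Exposed faces, the rearrangement inequality and the vertices -/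

/-- A subset of a finite configuration on which a functional attains its maximum spans an exposed
face of the convex hull. -/
theorem isExposed_convexHull {E : Type*} [AddCommGroup E] [Module ℝ E] [TopologicalSpace E]
    {S T : Set E} (hTS : T ⊆ S) (l : StrongDual ℝ E) (c : ℝ) (hle : ∀ x ∈ S, l x ≤ c)
    (heq : ∀ x ∈ S, l x = c ↔ x ∈ T) :
    IsExposed ℝ (convexHull ℝ S) (convexHull ℝ T) := by
  intro hne
  obtain ⟨t, ht⟩ := convexHull_nonempty_iff.1 hne
  have hle' : ∀ x ∈ convexHull ℝ S, l x ≤ c := fun x hx =>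
    convexHull_min (t := {x | l x ≤ c}) hle (convex_halfSpace_le l.toLinearMap.isLinear c) hx
  have hT : ∀ x ∈ convexHull ℝ T, l x = c := fun x hx =>
    convexHull_min (t := {x | l x = c}) (fun y hy => (heq y (hTS hy)).2 hy)
      (convex_hyperplane l.toLinearMap.isLinear c) hx
  -- The union of `{l < c}` and `convexHull ℝ T` is convex: a proper mixture involving a point with
  -- `l < c` again has `l < c`. It contains `S`, hence its hull.
  have hK : ∀ x ∈ convexHull ℝ S, l x < c ∨ x ∈ convexHull ℝ T := by
    refine fun x hx => convexHull_min (t := {x | l x < c ∨ x ∈ convexHull ℝ T}) ?_ ?_ hx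
    · intro y hy
      rcases (hle y hy).lt_or_eq with h | h
      · exact Or.inl h
      · exact Or.inr (subset_convexHull ℝ T ((heq y hy).1 h))
    · rw [convex_iff_forall_pos]
      rintro y hy z hz a b ha hb hab
      have hyc : l y ≤ c := hy.elim le_of_lt fun h => (hT y h).le
      have hzc : l z ≤ c := hz.elim le_of_lt fun h => (hT z h).le
      rcases hy with hy | hy
      · left
        simp only [map_add, map_smul, smul_eq_mul]
        have hb' : b = 1 - a := by linarith
        subst hb'
        nlinarith
      · rcases hz with hz | hz
        · left
          simp only [map_add, map_smul, smul_eq_mul]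
          have ha' : a = 1 - b := by linarith
          subst ha'
          nlinarith
        · exact Or.inr (convex_convexHull ℝ T hy hz ha.le hb.le hab)
  refine ⟨l, Set.Subset.antisymm ?_ ?_⟩
  · exact fun x hx => ⟨convexHull_mono hTS hx, fun y hy => (hT x hx).symm ▸ hle' y hy⟩
  · rintro x ⟨hx, hmax⟩
    refine (hK x hx).resolve_left fun h => ?_
    have h1 := hmax t (subset_convexHull ℝ S (hTS ht))
    rw [(heq t (hTS ht)).2 ht] at h1
    linarith

theorem sum_mul_perm_le {n : ℕ} {φ : Fin n → ℝ} (hφ : Monotone φ) (π ρ : Equiv.Perm (Fin n)) :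
    ∑ j, φ (π j) * ((ρ j : ℕ) : ℝ) ≤ ∑ j, φ (π j) * ((π j : ℕ) : ℝ) := by
  have h : Monovary (fun j => φ (π j)) (fun j => ((π j : ℕ) : ℝ)) := fun i j hij =>
    hφ (Fin.le_def.2 (Nat.cast_le.1 (le_of_lt hij)))
  simpa using h.sum_mul_comp_perm_le_sum_mul (σ := ρ.trans π.symm)

theorem sum_mul_perm_eq_iff {n : ℕ} {φ : Fin n → ℝ} (hφ : Monotone φ)
    (π ρ : Equiv.Perm (Fin n)) :
    ∑ j, φ (π j) * ((ρ j : ℕ) : ℝ) = ∑ j, φ (π j) * ((π j : ℕ) : ℝ) ↔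
      ∀ a b, ρ a < ρ b → φ (π a) ≤ φ (π b) := by
  have h : Monovary (fun j => φ (π j)) (fun j => ((π j : ℕ) : ℝ)) := fun i j hij =>
    hφ (Fin.le_def.2 (Nat.cast_le.1 (le_of_lt hij)))
  have := h.sum_mul_comp_perm_eq_sum_mul_iff (σ := ρ.trans π.symm)
  simpa [Monovary] using this

/-- Where `φ` is strictly monotone, the maximum in the rearrangement inequality pins down the
permutation. -/
theorem apply_eq_of_sum_mul_perm_eq {n : ℕ} {φ : Fin n → ℝ} (hφ : Monotone φ)
    {π ρ : Equiv.Perm (Fin n)}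
    (h : ∑ j, φ (π j) * ((ρ j : ℕ) : ℝ) = ∑ j, φ (π j) * ((π j : ℕ) : ℝ)) {p : Fin n}
    (hlt : ∀ u < π p, φ u < φ (π p)) (hgt : ∀ u > π p, φ (π p) < φ u) : ρ p = π p := by
  rw [sum_mul_perm_eq_iff hφ] at h
  have hinj : Function.Injective fun u => ρ (π.symm u) := ρ.injective.comp π.symm.injective
  have h1 : ∀ u < π p, ρ (π.symm u) < ρ p := by
    intro u hu
    refine lt_of_not_ge fun hle => ?_
    rcases hle.lt_or_eq with hlt' | heq
    · have := h _ _ hlt'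
      rw [Equiv.apply_symm_apply] at this
      exact absurd (hlt u hu) this.not_gt
    · have := ρ.injective heq
      rw [this, Equiv.apply_symm_apply] at hu
      exact lt_irrefl _ hu
  have h2 : ∀ u > π p, ρ p < ρ (π.symm u) := by
    intro u hu
    refine lt_of_not_ge fun hle => ?_
    rcases hle.lt_or_eq with hlt' | heq
    · have := h _ _ hlt'
      rw [Equiv.apply_symm_apply] at this
      exact absurd (hgt u hu) this.not_gt
    · have := ρ.injective heq
      rw [← this, Equiv.apply_symm_apply] at hu
      exact lt_irrefl _ hu
  -- At least as many values lie below `ρ p` as below `π p`, and likewise above; this leaves only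
  -- equality.
  have c1 : (Iio (π p)).card ≤ (Iio (ρ p)).card :=
    card_le_card_of_injOn _ (fun u hu => by simpa using h1 u (by simpa using hu)) hinj.injOn
  have c2 : (Ioi (π p)).card ≤ (Ioi (ρ p)).card :=
    card_le_card_of_injOn _ (fun u hu => by simpa using h2 u (by simpa using hu)) hinj.injOn
  rw [Fin.card_Iio, Fin.card_Iio] at c1
  rw [Fin.card_Ioi, Fin.card_Ioi] at c2
  have := (π p).2
  have := (ρ p).2
  ext
  omega

theorem permPoint_injective {n : ℕ} : Function.Injective (permPoint (n := n)) := by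
  intro π ρ h
  ext j
  have := congrFun h j
  simpa [permPoint] using this

/-- The functional with the given coefficients. -/
noncomputable def coordFunctional {n : ℕ} (w : Fin n → ℝ) : StrongDual ℝ (Fin n → ℝ) :=
  ∑ j, w j • ContinuousLinearMap.proj j

theorem coordFunctional_apply {n : ℕ} (w x : Fin n → ℝ) :
    coordFunctional w x = ∑ j, w j * x j := by
  simp [coordFunctional]

theorem sum_mul_permPoint {n : ℕ} (w : Fin n → ℝ) (π : Equiv.Perm (Fin n)) :
    ∑ j, w j * permPoint π j = ∑ j, w j * ((π j : ℕ) : ℝ) + ∑ j, w j := by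
  simp [permPoint, mul_add, sum_add_distrib]

theorem extremePoints_bridgePolytope {n : ℕ} (J : Finset (Fin n)) :
    Set.extremePoints ℝ (bridgePolytope J) = permPoint '' permSet J := by
  refine Set.Subset.antisymm extremePoints_convexHull_subset ?_
  rintro _ ⟨π, hπ, rfl⟩
  rw [← isExtreme_singleton, ← convexHull_singleton (𝕜 := ℝ)]
  refine (isExposed_convexHull (by simpa using ⟨π, hπ, rfl⟩)
    (coordFunctional fun j => ((π j : ℕ) : ℝ))
    (coordFunctional (fun j => ((π j : ℕ) : ℝ)) (permPoint π)) ?_ ?_).isExtreme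
  all_goals
    rintro _ ⟨ρ, hρ, rfl⟩
    simp only [coordFunctional_apply, sum_mul_permPoint, add_le_add_iff_right, add_left_inj]
  · exact sum_mul_perm_le (φ := fun v => ((v : ℕ) : ℝ)) (fun a b h => Nat.cast_le.2 h) π ρ
  · constructor
    · intro h
      have : ρ = π := Equiv.ext fun p =>
        apply_eq_of_sum_mul_perm_eq (φ := fun v => ((v : ℕ) : ℝ))
          (fun a b h => Nat.cast_le.2 h) h (fun u hu => by exact_mod_cast hu)
          (fun u hu => by exact_mod_cast hu)
      rw [this]; rfl
    · intro h
      rw [permPoint_injective h]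

/-! ### Swaps across fixed values give edges -/

/-- The identity with the interval `[i, l]` collapsed to `i`. -/
noncomputable def collapse {n : ℕ} (i l v : Fin n) : ℝ :=
  if i ≤ v ∧ v ≤ l then ((i : ℕ) : ℝ) else ((v : ℕ) : ℝ)

theorem collapse_of_mem {n : ℕ} {i l v : Fin n} (h : i ≤ v ∧ v ≤ l) :
    collapse i l v = ((i : ℕ) : ℝ) := if_pos h

theorem monotone_collapse {n : ℕ} (i l : Fin n) : Monotone (collapse i l) := by
  intro u v h
  unfold collapse
  split_ifs <;> norm_cast <;> grind

theorem collapse_lt {n : ℕ} {i l u v : Fin n} (h : u < v)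
    (hv : ¬ (i ≤ v ∧ v ≤ l) ∨ ¬ (i ≤ u ∧ u ≤ l)) : collapse i l u < collapse i l v := by
  unfold collapse
  split_ifs <;> norm_cast <;> grind

theorem collapse_swap {n : ℕ} {i l : Fin n} (h : i < l) (v : Fin n) :
    collapse i l (Equiv.swap i l v) = collapse i l v := by
  by_cases h1 : v = i
  · subst h1
    rw [Equiv.swap_apply_left, collapse_of_mem ⟨h.le, le_rfl⟩, collapse_of_mem ⟨le_rfl, h.le⟩]
  · by_cases h2 : v = l
    · subst h2
      rw [Equiv.swap_apply_right, collapse_of_mem ⟨le_rfl, h.le⟩, collapse_of_mem ⟨h.le, le_rfl⟩]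
    · rw [Equiv.swap_apply_of_ne_of_ne h1 h2]

theorem eq_or_eq_swap_mul {α : Type*} [DecidableEq α] {π ρ : Equiv.Perm α} {i l : α}
    (h : ∀ p, π p ≠ i → π p ≠ l → ρ p = π p) : ρ = π ∨ ρ = Equiv.swap i l * π := by
  obtain ⟨a, rfl⟩ := π.surjective i
  obtain ⟨b, rfl⟩ := π.surjective l
  have hab : ∀ p, p = a ∨ p = b → ρ p = π a ∨ ρ p = π b := by
    intro p hp
    by_contra! hc
    obtain ⟨q, hq⟩ := π.surjective (ρ p)
    rw [← hq] at hc
    have := ρ.injective ((h q hc.1 hc.2).trans hq)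
    grind
  have ha := hab a (Or.inl rfl)
  have hb := hab b (Or.inr rfl)
  have hinj : ρ a = ρ b → a = b := fun h => ρ.injective h
  have hinj' : π a = π b → a = b := fun h => π.injective h
  by_cases hc : ρ a = π a
  · left
    ext1 p
    by_cases h1 : p = a
    · grind
    · by_cases h2 : p = b
      · grind
      · exact h p (fun h => h1 (π.injective h)) (fun h => h2 (π.injective h))
  · right
    ext1 p
    rw [Equiv.Perm.mul_apply]
    by_cases h1 : p = a
    · rw [h1, Equiv.swap_apply_left]; grind
    · by_cases h2 : p = b
      · rw [h2, Equiv.swap_apply_right]; grind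
      · rw [Equiv.swap_apply_of_ne_of_ne (fun h => h1 (π.injective h))
          (fun h => h2 (π.injective h))]
        exact h p (fun h => h1 (π.injective h)) (fun h => h2 (π.injective h))

/-- The sign of the constraint at a position. -/
noncomputable def excSign {n : ℕ} (J : Finset (Fin n)) (j : Fin n) : ℝ := if j ∈ J then 1 else -1

theorem le_excSign_mul {n : ℕ} {J : Finset (Fin n)} {ρ : Equiv.Perm (Fin n)} (hρ : ρ ∈ permSet J)
    (j : Fin n) : excSign J j * ((j : ℕ) : ℝ) ≤ excSign J j * ((ρ j : ℕ) : ℝ) := by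
  unfold excSign
  split_ifs with h
  · have : ((j : ℕ) : ℝ) ≤ ((ρ j : ℕ) : ℝ) := by exact_mod_cast hρ.1 j h
    linarith
  · have : ((ρ j : ℕ) : ℝ) ≤ ((j : ℕ) : ℝ) := by exact_mod_cast hρ.2 j h
    linarith

theorem excSign_mul_inj {n : ℕ} {J : Finset (Fin n)} {j v : Fin n}
    (h : excSign J j * ((j : ℕ) : ℝ) = excSign J j * ((v : ℕ) : ℝ)) : v = j := by
  unfold excSign at h
  ext
  split_ifs at h
  · have : ((j : ℕ) : ℝ) = ((v : ℕ) : ℝ) := by linarith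
    exact_mod_cast this.symm
  · have : ((j : ℕ) : ℝ) = ((v : ℕ) : ℝ) := by linarith
    exact_mod_cast this.symm

/-- The functional has two parts. The collapsed rearrangement term forces a maximiser to agree with
`π` at every position whose value lies outside `[i, l]`. The term `P` uses the sign constraints of
`S_J` to force every position strictly between `i` and `l` to be fixed. Only the values `i` and `l`
remain free, and collapsing makes their exchange cost nothing. -/
theorem isExposed_segment_of_swap {n : ℕ} {J : Finset (Fin n)} {π ρ : Equiv.Perm (Fin n)}
    (hπ : π ∈ permSet J) (hρ : ρ ∈ permSet J) {i l : Fin n} (hil : i < l)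
    (hswap : Equiv.swap i l * π = ρ) (hfix : ∀ j, i < j → j < l → π j = j ∧ ρ j = j) :
    IsExposed ℝ (bridgePolytope J) (segment ℝ (permPoint π) (permPoint ρ)) := by
  rw [← convexHull_pair]
  set P : (Fin n → ℝ) → ℝ := fun x => ∑ j ∈ Ioo i l, excSign J j * x j with hP
  set w : Fin n → ℝ := fun j => collapse i l (π j) - if j ∈ Ioo i l then excSign J j else 0 with hw
  have hval : ∀ θ : Equiv.Perm (Fin n), coordFunctional w (permPoint θ) =
      ∑ j, collapse i l (π j) * ((θ j : ℕ) : ℝ) - P (fun j => ((θ j : ℕ) : ℝ)) + ∑ j, w j := by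
    intro θ
    rw [coordFunctional_apply, sum_mul_permPoint]
    simp only [hw, hP, sub_mul, sum_sub_distrib, ite_mul, zero_mul, sum_ite_mem, univ_inter]
  have hPle : ∀ θ ∈ permSet J, P (fun j => ((j : ℕ) : ℝ)) ≤ P (fun j => ((θ j : ℕ) : ℝ)) :=
    fun θ hθ => sum_le_sum fun j _ => le_excSign_mul hθ j
  have hPeq : ∀ θ ∈ permSet J, P (fun j => ((θ j : ℕ) : ℝ)) = P (fun j => ((j : ℕ) : ℝ)) →
      ∀ j, i < j → j < l → θ j = j := by
    intro θ hθ h j h1 h2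
    exact excSign_mul_inj ((sum_eq_sum_iff_of_le fun j _ => le_excSign_mul hθ j).1 h.symm j
      (mem_Ioo.2 ⟨h1, h2⟩))
  have hPfix : ∀ θ : Equiv.Perm (Fin n), (∀ j, i < j → j < l → θ j = j) →
      P (fun j => ((θ j : ℕ) : ℝ)) = P (fun j => ((j : ℕ) : ℝ)) := by
    intro θ h
    refine sum_congr rfl fun j hj => ?_
    rw [mem_Ioo] at hj
    simp only [h j hj.1 hj.2]
  have hPπ := hPfix π fun j h1 h2 => (hfix j h1 h2).1
  have hPρ := hPfix ρ fun j h1 h2 => (hfix j h1 h2).2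
  have hρφ : ∑ j, collapse i l (π j) * ((ρ j : ℕ) : ℝ) =
      ∑ j, collapse i l (π j) * ((π j : ℕ) : ℝ) := by
    rw [sum_mul_perm_eq_iff (monotone_collapse i l)]
    intro a b hab
    rw [← collapse_swap hil (π a), ← collapse_swap hil (π b)]
    refine monotone_collapse i l ?_
    rw [← Equiv.Perm.mul_apply, ← Equiv.Perm.mul_apply, hswap]
    exact hab.le
  refine isExposed_convexHull ?_ (coordFunctional w) (coordFunctional w (permPoint π)) ?_ ?_
  · rintro x (rfl | rfl)
    · exact ⟨π, hπ, rfl⟩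
    · exact ⟨ρ, hρ, rfl⟩
  · rintro _ ⟨θ, hθ, rfl⟩
    rw [hval, hval, hPπ]
    have := hPle θ hθ
    have := sum_mul_perm_le (monotone_collapse i l) π θ
    linarith
  · rintro _ ⟨θ, hθ, rfl⟩
    rw [hval, hval, hPπ]
    constructor
    · intro h
      have h1 := hPle θ hθ
      have h2 := sum_mul_perm_le (monotone_collapse i l) π θ
      have h3 := hPeq θ hθ (by linarith)
      have h4 : ∑ j, collapse i l (π j) * ((θ j : ℕ) : ℝ) =
        ∑ j, collapse i l (π j) * ((π j : ℕ) : ℝ) := by linarith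
      have h5 : θ = π ∨ θ = Equiv.swap i l * π := by
        refine eq_or_eq_swap_mul fun p hpi hpl => ?_
        by_cases hmem : i ≤ π p ∧ π p ≤ l
        · have hlo := lt_of_le_of_ne hmem.1 (Ne.symm hpi)
          have hhi := lt_of_le_of_ne hmem.2 hpl
          have : π p = p := π.injective (hfix _ hlo hhi).1
          rw [this] at hlo hhi ⊢
          exact h3 p hlo hhi
        · exact apply_eq_of_sum_mul_perm_eq (monotone_collapse i l) h4
            (fun u hu => collapse_lt hu (Or.inl hmem)) (fun u hu => collapse_lt hu (Or.inr hmem))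
      rcases h5 with rfl | rfl
      · exact Or.inl rfl
      · exact Or.inr (by rw [hswap]; rfl)
    · rintro (h | h)
      · rw [permPoint_injective h, hPπ]
      · rw [permPoint_injective h, hPρ, hρφ]

/-! ### Every edge is such a swap: displacements as sums of moves -/

/-- The pair of values `i < l` can be exchanged: all values between are fixed, `i` may be raised
and `l` may be lowered. -/
structure IsMove {n : ℕ} (F U : Set (Fin n)) (i l : Fin n) : Prop where
  lt : i < l
  between : ∀ v, i < v → v < l → v ∈ F
  raise : i ∈ F → i ∈ U
  lower : l ∈ F → l ∉ U

/-- The sign and dominance conditions on the displacements of the values. -/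
structure IsDisplacement {n : ℕ} (F U : Set (Fin n)) (y : Fin n → ℤ) : Prop where
  prefix_nonneg : ∀ m, 0 ≤ ∑ v ∈ Iic m, y v
  sum_eq_zero : ∑ v, y v = 0
  nonneg : ∀ v ∈ F, v ∈ U → 0 ≤ y v
  nonpos : ∀ v ∈ F, v ∉ U → y v ≤ 0

/-- Let `i` be the first index with `y i ≠ 0`; its prefix sum makes `y i` positive. Let `l` be the
first later index that is not in `F` or has negative displacement; it exists because the total is
zero. Between them `y` is nonnegative, so the prefix sums on `[i, l)` are at least one and survive
the subtraction. The sum of all prefix sums drops, which drives later inductions. -/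
theorem IsDisplacement.exists_move {n : ℕ} {F U : Set (Fin n)} {y : Fin n → ℤ}
    (hy : IsDisplacement F U y) (hne : y ≠ 0) :
    ∃ i l, IsMove F U i l ∧ IsDisplacement F U (y - Pi.single i 1 + Pi.single l 1) ∧
      ∑ m, ∑ v ∈ Iic m, (y - Pi.single i 1 + Pi.single l 1 : Fin n → ℤ) v
        < ∑ m, ∑ v ∈ Iic m, y v := by
  classical
  have hpre : ∀ i l m, ∑ v ∈ Iic m, (y - Pi.single i 1 + Pi.single l 1 : Fin n → ℤ) v =
      ∑ v ∈ Iic m, y v - (if i ≤ m then 1 else 0) + (if l ≤ m then 1 else 0) := by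
    intro i l m
    simp [sum_add_distrib, sum_sub_distrib]
  have hex : (univ.filter fun v => y v ≠ 0).Nonempty := by
    obtain ⟨v, hv⟩ := Function.ne_iff.1 hne
    exact ⟨v, by simpa using hv⟩
  set i := (univ.filter fun v => y v ≠ 0).min' hex with hi
  have hiy : y i ≠ 0 := (mem_filter.1 (min'_mem _ hex)).2
  have hlow : ∀ v < i, y v = 0 := by
    intro v hv
    by_contra hc
    exact absurd (min'_le _ v (by simpa using hc)) (not_le.2 hv)
  have hsplit : ∀ m, i ≤ m → ∑ v ∈ Iic m, y v = y i + ∑ v ∈ Ioc i m, y v := by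
    intro m hm
    rw [← add_sum_erase (Iic m) y (mem_Iic.2 hm)]
    congr 1
    refine (sum_subset (fun v hv => ?_) fun v hv hv' => ?_).symm
    · rw [mem_Ioc] at hv
      exact mem_erase.2 ⟨hv.1.ne', mem_Iic.2 hv.2⟩
    · rw [mem_erase, mem_Iic] at hv
      rw [mem_Ioc] at hv'
      exact hlow v (lt_of_le_of_ne (not_lt.1 fun h => hv' ⟨h, hv.2⟩) hv.1)
  have hipos : 0 < y i := by
    have := hy.prefix_nonneg i
    rw [hsplit i le_rfl, Ioc_self, sum_empty, add_zero] at this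
    exact lt_of_le_of_ne this (Ne.symm hiy)
  have hex' : (univ.filter fun v => i < v ∧ (v ∉ F ∨ y v < 0)).Nonempty := by
    by_contra hc
    rw [not_nonempty_iff_eq_empty, filter_eq_empty_iff] at hc
    have : 0 < ∑ v, y v := by
      refine sum_pos' (fun v _ => ?_) ⟨i, mem_univ i, hipos⟩
      rcases lt_trichotomy v i with h | h | h
      · exact (hlow v h).ge
      · exact h ▸ hipos.le
      · have := hc (mem_univ v)
        grind
    exact this.ne' hy.sum_eq_zero
  set l := (univ.filter fun v => i < v ∧ (v ∉ F ∨ y v < 0)).min' hex' with hl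
  obtain ⟨hil, hly⟩ := (mem_filter.1 (min'_mem _ hex')).2
  rw [← hl] at hil hly
  have hbet : ∀ v, i < v → v < l → v ∈ F ∧ 0 ≤ y v := by
    intro v h1 h2
    by_contra hc
    refine absurd (min'_le _ v ?_) (not_le.2 h2)
    rw [mem_filter]
    exact ⟨mem_univ v, h1, by grind⟩
  refine ⟨i, l, ⟨hil, fun v h1 h2 => (hbet v h1 h2).1, ?_, ?_⟩, ⟨?_, ?_, ?_, ?_⟩, ?_⟩
  · intro hF
    by_contra hU
    exact absurd (hy.nonpos i hF hU) (not_le.2 hipos)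
  · intro hF hU
    have := hy.nonneg l hF hU
    grind
  · intro m
    rw [hpre]
    have h0 := hy.prefix_nonneg m
    by_cases h1 : i ≤ m
    · by_cases h2 : l ≤ m
      · simpa [h1, h2] using h0
      · have h3 : 0 ≤ ∑ v ∈ Ioc i m, y v := sum_nonneg fun v hv => by
          rw [mem_Ioc] at hv
          exact (hbet v hv.1 (hv.2.trans_lt (not_le.1 h2))).2
        rw [hsplit m h1]
        simp only [h1, h2, if_true, if_false]
        omega
    · have h2 : ¬ l ≤ m := fun h => h1 (hil.le.trans h)
      simpa [h1, h2] using h0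
  · simp [sum_add_distrib, sum_sub_distrib, hy.sum_eq_zero]
  · intro v hF hU
    have := hy.nonneg v hF hU
    simp only [Pi.add_apply, Pi.sub_apply, Pi.single_apply]
    split_ifs <;> grind
  · intro v hF hU
    have := hy.nonpos v hF hU
    simp only [Pi.add_apply, Pi.sub_apply, Pi.single_apply]
    split_ifs <;> grind
  · refine sum_lt_sum (fun m _ => ?_) ⟨i, mem_univ i, ?_⟩
    · rw [hpre]
      split_ifs <;> grind
    · rw [hpre, if_pos le_rfl, if_neg (not_le.2 hil)]
      omega

/-- Displacements are nonnegative combinations of moves, so a functional that is nonpositive on all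
moves is nonpositive on displacements. -/
theorem IsDisplacement.sum_mul_nonpos {n : ℕ} {F U : Set (Fin n)} {w : Fin n → ℝ}
    (hw : ∀ i l, IsMove F U i l → w i ≤ w l) {y : Fin n → ℤ} (hy : IsDisplacement F U y) :
    ∑ v, w v * y v ≤ 0 := by
  induction hN : (∑ m, ∑ v ∈ Iic m, y v).toNat using Nat.strong_induction_on generalizing y with
  | _ N ih =>
    by_cases hne : y = 0
    · simp [hne]
    obtain ⟨i, l, hm, hd, hlt⟩ := hy.exists_move hne
    have h0 := sum_nonneg fun m (_ : m ∈ univ) => hd.prefix_nonneg m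
    have := ih _ (by omega) hd rfl
    have h2 := hw i l hm
    simp only [Pi.add_apply, Pi.sub_apply, Int.cast_add, Int.cast_sub, mul_add, mul_sub,
      sum_add_distrib, sum_sub_distrib] at this
    simp [Pi.single_apply] at this
    linarith

/-- Distinct values on an initial segment sum to at least the smallest values, giving dominance. At
a value fixed by `π`, position and value coincide, so the constraint of `S_J` on `ρ` gives the sign.
-/
theorem isDisplacement_of_permSet {n : ℕ} {J : Finset (Fin n)} {π ρ : Equiv.Perm (Fin n)}
    (hρ : ρ ∈ permSet J) :
    IsDisplacement {v | π v = v} {v | v ∈ J}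
      (fun v => ((ρ (π.symm v) : ℕ) : ℤ) - ((v : ℕ) : ℤ)) := by
  refine ⟨fun m => ?_, ?_, ?_, ?_⟩
  · rw [sum_sub_distrib, sub_nonneg]
    have h : Antivary (fun v => if v ≤ m then (1 : ℤ) else 0) (fun v : Fin n => ((v : ℕ) : ℤ)) := by
      intro a b hab
      have : a < b := Fin.lt_def.2 (Nat.cast_lt.1 hab)
      show (if b ≤ m then (1 : ℤ) else 0) ≤ if a ≤ m then (1 : ℤ) else 0
      split_ifs <;> grind
    have := h.sum_mul_le_sum_mul_comp_perm (σ := π.symm.trans ρ)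
    have hI : univ.filter (· ≤ m) = Iic m := by ext; simp
    simpa only [ite_mul, one_mul, zero_mul, ← sum_filter, hI, Equiv.trans_apply] using this
  · rw [sum_sub_distrib, sub_eq_zero]
    exact Equiv.sum_comp (π.symm.trans ρ) fun v => ((v : ℕ) : ℤ)
  · intro v hv hJ
    have : π.symm v = v := π.symm_apply_eq.2 (Eq.symm hv)
    rw [this, sub_nonneg, Nat.cast_le]
    exact hρ.1 v hJ
  · intro v hv hJ
    have : π.symm v = v := π.symm_apply_eq.2 (Eq.symm hv)
    rw [this, sub_nonpos, Nat.cast_le]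
    exact hρ.2 v hJ

/-- A violation could only occur if the position carrying `i` or `l` were in `[i, l]`. Strictly
inside, that position is fixed and carries its own value; at the endpoint, `raise` and `lower`
exclude it. -/
theorem IsMove.swap_mul_mem {n : ℕ} {J : Finset (Fin n)} {π : Equiv.Perm (Fin n)}
    (hπ : π ∈ permSet J) {i l : Fin n} (hm : IsMove {v | π v = v} {v | v ∈ J} i l) :
    Equiv.swap i l * π ∈ permSet J := by
  obtain ⟨hlt, hb, hr, hl⟩ := hm
  simp only [Set.mem_ofPred_eq] at hb hr hl
  constructor
  · intro j hj
    have h1 := hπ.1 j hj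
    rw [Equiv.Perm.mul_apply, Equiv.swap_apply_def]
    split_ifs with h2 h3
    · exact h1.trans (h2.le.trans hlt.le)
    · by_contra! hc
      rw [h3] at h1
      rcases h1.lt_or_eq with h | h
      · have := hb j hc h
        exact h.ne (this.symm.trans h3)
      · subst h
        exact hl h3 hj
    · exact h1
  · intro j hj
    have h1 := hπ.2 j hj
    rw [Equiv.Perm.mul_apply, Equiv.swap_apply_def]
    split_ifs with h2 h3
    · by_contra! hc
      rw [h2] at h1
      rcases h1.lt_or_eq with h | h
      · have := hb j h hc
        exact h.ne' (this.symm.trans h2)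
      · subst h
        exact hj (hr h2)
    · rw [h3] at h1
      exact hlt.le.trans h1
    · exact h1

theorem exists_swap_of_isExposed_segment {n : ℕ} {J : Finset (Fin n)} {π ρ : Equiv.Perm (Fin n)}
    (hπ : π ∈ permSet J) (hρ : ρ ∈ permSet J) (hne : π ≠ ρ)
    (hexp : IsExposed ℝ (bridgePolytope J) (segment ℝ (permPoint π) (permPoint ρ))) :
    ∃ i l : Fin n, i < l ∧ Equiv.swap i l * π = ρ ∧
      ∀ j, i < j → j < l → π j = j ∧ ρ j = j := by
  obtain ⟨L, hL⟩ := hexp ⟨_, left_mem_segment ℝ _ _⟩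
  have hmem : ∀ θ ∈ permSet J, permPoint θ ∈ bridgePolytope J := fun θ hθ =>
    subset_convexHull ℝ _ ⟨θ, hθ, rfl⟩
  have hmax : ∀ x ∈ bridgePolytope J, L x ≤ L (permPoint π) := by
    have : permPoint π ∈ segment ℝ (permPoint π) (permPoint ρ) := left_mem_segment ℝ _ _
    rw [hL] at this
    exact this.2
  have hLρ : L (permPoint ρ) = L (permPoint π) := by
    have : permPoint ρ ∈ segment ℝ (permPoint π) (permPoint ρ) := right_mem_segment ℝ _ _
    rw [hL] at this
    exact le_antisymm (hmax _ (hmem ρ hρ)) (this.2 _ (hmem π hπ))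
  set c : Fin n → ℝ := fun j => L fun k => if j = k then 1 else 0 with hc
  set w : Fin n → ℝ := fun v => c (π.symm v) with hw
  have hLc : ∀ θ : Equiv.Perm (Fin n), L (permPoint θ) = ∑ j, c j * permPoint θ j := by
    intro θ
    have := LinearMap.pi_apply_eq_sum_univ L.toLinearMap (permPoint θ)
    simp only [smul_eq_mul, ContinuousLinearMap.coe_coe] at this
    rw [this]
    exact sum_congr rfl fun j _ => mul_comm _ _
  have hdiff : ∀ θ : Equiv.Perm (Fin n), L (permPoint θ) - L (permPoint π) =
      ∑ v, w v * ((((θ (π.symm v) : ℕ) : ℤ) - ((v : ℕ) : ℤ) : ℤ) : ℝ) := by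
    intro θ
    rw [hLc, hLc, ← sum_sub_distrib, ← Equiv.sum_comp π.symm]
    refine sum_congr rfl fun v _ => ?_
    simp only [hw, permPoint, Equiv.apply_symm_apply]
    push_cast
    ring
  have hmovediff : ∀ i l, i < l → L (permPoint (Equiv.swap i l * π)) - L (permPoint π) =
      (w i - w l) * (((l : ℕ) : ℝ) - ((i : ℕ) : ℝ)) := by
    intro i l hil
    rw [hdiff, ← sum_subset (subset_univ {i, l}), sum_pair hil.ne]
    · simp only [Equiv.Perm.mul_apply, Equiv.apply_symm_apply, Equiv.swap_apply_left,
        Equiv.swap_apply_right]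
      push_cast
      ring
    · intro v _ hv
      simp only [mem_insert, mem_singleton, not_or] at hv
      simp [Equiv.swap_apply_of_ne_of_ne hv.1 hv.2]
  have hcast : ∀ i l : Fin n, i < l → 0 < ((l : ℕ) : ℝ) - ((i : ℕ) : ℝ) := fun i l h =>
    sub_pos.2 (by exact_mod_cast h)
  have hwle : ∀ i l, IsMove {v | π v = v} {v | v ∈ J} i l → w i ≤ w l := by
    intro i l hm
    have h1 := hmax _ (hmem _ (hm.swap_mul_mem hπ))
    have h2 := hmovediff i l hm.lt
    have h3 := hcast i l hm.lt
    by_contra! h4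
    have := mul_pos (sub_pos.2 h4) h3
    linarith
  have hy := isDisplacement_of_permSet (π := π) hρ
  obtain ⟨i, l, hm, hd, -⟩ := hy.exists_move (by
    intro h0
    refine hne (Equiv.ext fun p => ?_)
    have := congrFun h0 (π p)
    simp only [Equiv.symm_apply_apply, Pi.zero_apply] at this
    ext
    omega)
  have hrest := hd.sum_mul_nonpos hwle
  have htot := hdiff ρ
  rw [hLρ, sub_self] at htot
  have hle := hwle i l hm
  -- The total is zero, and both the first move and the remaining displacement contribute
  -- nonpositively, so the first move contributes zero.
  have hwil : w i = w l := by
    simp only [Pi.add_apply, Pi.sub_apply, Int.cast_add, Int.cast_sub (R := ℝ) (_ - _ : ℤ), mul_add,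
      mul_sub, sum_add_distrib, sum_sub_distrib] at hrest htot
    simp [Pi.single_apply] at hrest htot
    simp only [mul_sub, sum_sub_distrib] at hrest htot
    linarith
  have hLθ : L (permPoint (Equiv.swap i l * π)) = L (permPoint π) := by
    have := hmovediff i l hm.lt
    rw [hwil, sub_self, zero_mul] at this
    linarith
  have hθ := hm.swap_mul_mem hπ
  have hseg : permPoint (Equiv.swap i l * π) ∈ segment ℝ (permPoint π) (permPoint ρ) := by
    rw [hL]
    exact ⟨hmem _ hθ, fun x hx => hLθ ▸ hmax x hx⟩
  have hext : permPoint (Equiv.swap i l * π) ∈ Set.extremePoints ℝ (bridgePolytope J) := by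
    rw [extremePoints_bridgePolytope]
    exact ⟨_, hθ, rfl⟩
  have hor := (mem_extremePoints_iff_forall_segment.1 hext).2 _ (hmem π hπ) _ (hmem ρ hρ) hseg
  have hswapne : π ≠ Equiv.swap i l * π := by
    intro h
    have := congrArg (fun σ => σ (π.symm i)) h
    simp only [Equiv.Perm.mul_apply, Equiv.apply_symm_apply, Equiv.swap_apply_left] at this
    exact hm.lt.ne this
  have hρeq : Equiv.swap i l * π = ρ :=
    (hor.elim (fun h => absurd (permPoint_injective h) hswapne) fun h =>
      permPoint_injective h).symm
  refine ⟨i, l, hm.lt, hρeq, fun j h1 h2 => ?_⟩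
  have hj : π j = j := hm.between j h1 h2
  refine ⟨hj, ?_⟩
  rw [← hρeq, Equiv.Perm.mul_apply, hj, Equiv.swap_apply_of_ne_of_ne h1.ne' h2.ne]

theorem oneSkeleton_adj_iff {n : ℕ} {J : Finset (Fin n)} (π ρ : permSet J) :
    (oneSkeleton J).Adj π ρ ↔ ∃ i l : Fin n, i < l ∧ Equiv.swap i l * π.1 = ρ.1 ∧
      ∀ j, i < j → j < l → π.1 j = j ∧ ρ.1 j = j := by
  constructor
  · rintro ⟨hne, hexp⟩
    exact exists_swap_of_isExposed_segment π.2 ρ.2 (fun h => hne (Subtype.ext h)) hexp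
  · rintro ⟨i, l, hil, hswap, hfix⟩
    refine ⟨?_, isExposed_segment_of_swap π.2 ρ.2 hil hswap hfix⟩
    rintro rfl
    have := congrArg (fun σ => σ (π.1.symm i)) hswap
    simp only [Equiv.Perm.mul_apply, Equiv.apply_symm_apply, Equiv.swap_apply_left] at this
    exact hil.ne' this

/-! ### Length of affine permutations -/

/-- The number of inversions of the `n`-periodic extension of a map `f`, with `f v = x` and
`f w = y` for `v < w`, between the classes of `v` and `w`. -/
def pairInversions (n x y : ℕ) : ℤ := (if y < x then 1 else 0) + (if x + n < y then 1 else 0)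

/-- The length of an affine permutation given by its window of values. -/
def affineLength {n : ℕ} (f : Fin n → ℕ) : ℤ :=
  ∑ p, ∑ q, if p < q then pairInversions n (f p) (f q) else 0

theorem affineLength_le {n : ℕ} (f : Fin n → ℕ) : affineLength f ≤ 2 * n * n := by
  have h : ∀ p q, (if p < q then pairInversions n (f p) (f q) else 0) ≤ 2 := by
    intro p q
    unfold pairInversions
    split_ifs <;> simp
  calc affineLength f ≤ ∑ _p : Fin n, ∑ _q : Fin n, (2 : ℤ) :=
        sum_le_sum fun p _ => sum_le_sum fun q _ => h p q
    _ = 2 * n * n := by simp; ring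

theorem sum_eq_add_add_sum_compl {α : Type*} [Fintype α] [DecidableEq α] {i l : α} (h : i ≠ l)
    (F : α → ℤ) : ∑ p, F p = F i + F l + ∑ p ∈ univ \ {i, l}, F p := by
  rw [← sum_sdiff (subset_univ {i, l}), sum_pair h, add_comm]

/-- A bridge raises the length by one. -/
theorem affineLength_comp_swap {n : ℕ} {f : Fin n → ℕ} {i l : Fin n} (hil : i < l)
    (hfix : ∀ h, i < h → h < l → IsFixedPos f h) (hi : (l : ℕ) ≤ f i) (hl : f l ≤ i + n)
    (hlt : f i < f l) : affineLength (f ∘ Equiv.swap i l) = affineLength f + 1 := by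
  have hil' : (i : ℕ) < l := hil
  have hln := l.2
  set τ := Equiv.swap i l with hτ
  set D : Fin n → Fin n → ℤ := fun p q =>
    (if τ p < τ q then pairInversions n (f p) (f q) else 0) -
      (if p < q then pairInversions n (f p) (f q) else 0) with hD
  -- Reindexing by `τ` keeps the entries and permutes the order of the positions, so only pairs
  -- meeting `{i, l}` can change.
  have h1 : affineLength (f ∘ τ) =
      ∑ p, ∑ q, if τ p < τ q then pairInversions n (f p) (f q) else 0 := by
    unfold affineLength
    rw [← Equiv.sum_comp τ]
    refine sum_congr rfl fun p _ => ?_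
    rw [← Equiv.sum_comp τ]
    simp [hτ]
  have h2 : affineLength (f ∘ τ) - affineLength f = ∑ p, ∑ q, D p q := by
    rw [h1]
    simp only [affineLength, hD, sum_sub_distrib]
  have hτi : τ i = l := Equiv.swap_apply_left i l
  have hτl : τ l = i := Equiv.swap_apply_right i l
  have hτh : ∀ h ∈ univ \ {i, l}, τ h = h ∧ h ≠ i ∧ h ≠ l := by
    intro h hh
    simp only [mem_sdiff, mem_univ, mem_insert, mem_singleton, not_or, true_and] at hh
    exact ⟨Equiv.swap_apply_of_ne_of_ne hh.1 hh.2, hh⟩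
  -- Outside `[i, l]`, `h` is on the same side of both positions and the terms just trade places.
  -- Inside, `f h` is `h` or `h + n`, while the bounds on `f i` and `f l` put both strictly between
  -- `h` and `h + n`, so `h` compares alike with the two entries.
  have hmid : ∀ h ∈ univ \ {i, l}, D i h + D l h + (D h i + D h l) = 0 := by
    intro h hh
    obtain ⟨h3, h4, h5⟩ := hτh h hh
    simp only [hD, hτi, hτl, h3]
    rcases lt_or_gt_of_ne h4 with h6 | h6
    · have h7 := h6.trans hil
      simp only [h6, h7, h6.not_gt, h7.not_gt, if_true, if_false]
      ring
    · rcases lt_or_gt_of_ne h5 with h7 | h7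
      · have h8 := hfix h h6 h7
        have h6' : (i : ℕ) < h := h6
        have h7' : (h : ℕ) < l := h7
        simp only [h6, h7, h6.not_gt, h7.not_gt, if_true, if_false, pairInversions]
        rcases h8 with h8 | h8
        · have e1 : (h : ℕ) < f i := by omega
          have e2 : (h : ℕ) < f l := by omega
          have e3 : ¬ f i + n < h := by omega
          have e4 : ¬ f l + n < h := by omega
          have e5 : ¬ (h : ℕ) + n < f l := by omega
          have e6 : ¬ (h : ℕ) + n < f i := by omega
          simp [h8, e1, e2, e3, e4, e5, e6, e1.not_gt, e2.not_gt]
        · have e1 : f i < h + n := by omega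
          have e2 : f l < h + n := by omega
          have e5 : ¬ (f i < h) := by omega
          have e6 : ¬ (f l < h) := by omega
          have e7 : ¬ (h : ℕ) + n + n < f i := by omega
          have e8 : ¬ (h : ℕ) + n + n < f l := by omega
          simp [h8, e1, e2, e5, e6, e7, e8, e1.not_gt, e2.not_gt]
      · have h8 := hil.trans h7
        simp only [h7, h8, h7.not_gt, h8.not_gt, if_true, if_false]
        ring
  have hout : ∀ p ∈ univ \ {i, l}, ∀ q ∈ univ \ {i, l}, D p q = 0 := by
    intro p hp q hq
    simp only [hD, (hτh p hp).1, (hτh q hq).1, sub_self]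
  have hin : D i i + D i l + (D l i + D l l) = 1 := by
    have e1 : ¬ f i + n < f l := by omega
    have e2 : ¬ f l + n < f i := by omega
    simp only [hD, hτi, hτl, pairInversions]
    simp [hil, hil.not_gt, hlt, hlt.not_gt, e1, e2]
  have h3 : ∑ p, ∑ q, D p q = 1 := by
    simp only [sum_eq_add_add_sum_compl hil.ne, sum_add_distrib]
    rw [sum_eq_zero fun p hp => sum_eq_zero fun q hq => hout p hp q hq]
    have := sum_eq_zero hmid
    simp only [sum_add_distrib] at this
    linarith
  linarith

/-! ### Edges change the length by one -/

/-- The natural lift of `π⁻¹` for `π ∈ S_J`: positions in `J` are shifted by `n`. -/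
def lift {n : ℕ} (J : Finset (Fin n)) (π : Equiv.Perm (Fin n)) (v : Fin n) : ℕ :=
  (π.symm v : ℕ) + if π.symm v ∈ J then n else 0

theorem lift_injective {n : ℕ} (J : Finset (Fin n)) (π : Equiv.Perm (Fin n)) :
    Function.Injective (lift J π) := by
  intro u v h
  have h1 := (π.symm u).2
  have h2 := (π.symm v).2
  have h3 : π.symm u = π.symm v := by
    unfold lift at h
    ext
    split_ifs at h <;> omega
  exact π.symm.injective h3

theorem lift_swap_mul {n : ℕ} (J : Finset (Fin n)) (π : Equiv.Perm (Fin n)) (i l : Fin n) :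
    lift J (Equiv.swap i l * π) = lift J π ∘ Equiv.swap i l := by
  rfl

theorem isFixedPos_lift_iff {n : ℕ} {J : Finset (Fin n)} {π : Equiv.Perm (Fin n)} {v : Fin n} :
    IsFixedPos (lift J π) v ↔ π v = v := by
  have h1 := (π.symm v).2
  have h2 := v.2
  rw [eq_comm, ← π.symm_apply_eq, Fin.ext_iff]
  unfold IsFixedPos lift
  split_ifs <;> omega

/-- `π` and `ρ` are exchanged by the transposition of two values between which all values are
fixed. -/
structure IsEdge {n : ℕ} (π ρ : Equiv.Perm (Fin n)) (i l : Fin n) : Prop where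
  lt : i < l
  swap_mul : Equiv.swap i l * π = ρ
  fixed : ∀ j, i < j → j < l → π j = j ∧ ρ j = j

theorem IsEdge.symm {n : ℕ} {π ρ : Equiv.Perm (Fin n)} {i l : Fin n} (h : IsEdge π ρ i l) :
    IsEdge ρ π i l :=
  ⟨h.lt, by rw [← h.swap_mul, Equiv.swap_mul_self_mul], fun j h1 h2 => (h.fixed j h1 h2).symm⟩

theorem IsEdge.lift_eq {n : ℕ} {π ρ : Equiv.Perm (Fin n)} {i l : Fin n} (h : IsEdge π ρ i l)
    (J : Finset (Fin n)) : lift J ρ = lift J π ∘ Equiv.swap i l := by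
  rw [← h.swap_mul, lift_swap_mul]

/-- The position carrying `i` in `π` carries `l` in `ρ`. If it is outside `J` it is at least `l`; if
it is in `J` the lift is at least `n`. `IsEdge.lift_le` is the mirror image. -/
theorem IsEdge.le_lift {n : ℕ} {J : Finset (Fin n)} {π ρ : Equiv.Perm (Fin n)} {i l : Fin n}
    (h : IsEdge π ρ i l) (hπ : π ∈ permSet J) (hρ : ρ ∈ permSet J) : (l : ℕ) ≤ lift J π i := by
  unfold lift
  obtain ⟨a, rfl⟩ := π.surjective i
  rw [Equiv.symm_apply_apply]
  split_ifs with ha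
  · omega
  · have h1 : π a ≤ a := hπ.2 a ha
    by_contra! hc
    have hal : a < l := hc
    have h2 : π a = a := by
      rcases h1.lt_or_eq with h1 | h1
      · exact (h.fixed a h1 hal).1
      · exact h1
    have h3 := hρ.2 a ha
    rw [← h.swap_mul, Equiv.Perm.mul_apply, Equiv.swap_apply_left] at h3
    exact absurd hal h3.not_gt

theorem IsEdge.lift_le {n : ℕ} {J : Finset (Fin n)} {π ρ : Equiv.Perm (Fin n)} {i l : Fin n}
    (h : IsEdge π ρ i l) (hπ : π ∈ permSet J) (hρ : ρ ∈ permSet J) : lift J π l ≤ i + n := by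
  unfold lift
  obtain ⟨b, rfl⟩ := π.surjective l
  rw [Equiv.symm_apply_apply]
  split_ifs with hb
  · have h1 : b ≤ π b := hπ.1 b hb
    by_contra! hc
    have hib : i < b := by rw [Fin.lt_def]; omega
    have h2 : π b = b := by
      rcases h1.lt_or_eq with h1 | h1
      · exact (h.fixed b hib h1).1
      · exact h1.symm
    have h3 := hρ.1 b hb
    rw [← h.swap_mul, Equiv.Perm.mul_apply, Equiv.swap_apply_right] at h3
    exact absurd hib h3.not_gt
  · omega

/-- The bounds `l ≤ lift J π i < lift J π l ≤ i + n` exclude both fixed-point values at `i` and at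
`l`. -/
theorem IsEdge.ne_of_lift_lt {n : ℕ} {J : Finset (Fin n)} {π ρ : Equiv.Perm (Fin n)} {i l : Fin n}
    (h : IsEdge π ρ i l) (hπ : π ∈ permSet J) (hρ : ρ ∈ permSet J)
    (hlt : lift J π i < lift J π l) : π i ≠ i ∧ π l ≠ l := by
  have h1 := h.le_lift hπ hρ
  have h2 := h.lift_le hπ hρ
  have h3 : (i : ℕ) < l := h.lt
  constructor <;> intro hc <;> rcases isFixedPos_lift_iff (J := J).2 hc with h4 | h4 <;> omega

theorem IsEdge.affineLength_eq {n : ℕ} {J : Finset (Fin n)} {π ρ : Equiv.Perm (Fin n)}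
    {i l : Fin n} (h : IsEdge π ρ i l) (hπ : π ∈ permSet J) (hρ : ρ ∈ permSet J)
    (hlt : lift J π i < lift J π l) :
    affineLength (lift J ρ) = affineLength (lift J π) + 1 := by
  rw [h.lift_eq]
  exact affineLength_comp_swap h.lt
    (fun j h1 h2 => isFixedPos_lift_iff.2 (h.fixed j h1 h2).1) (h.le_lift hπ hρ)
    (h.lift_le hπ hρ) hlt

theorem IsEdge.affineLength_le {n : ℕ} {J : Finset (Fin n)} {π ρ : Equiv.Perm (Fin n)}
    {i l : Fin n} (h : IsEdge π ρ i l) (hπ : π ∈ permSet J) (hρ : ρ ∈ permSet J) :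
    affineLength (lift J ρ) ≤ affineLength (lift J π) + 1 := by
  rcases lt_or_ge (lift J π i) (lift J π l) with hlt | hge
  · exact (h.affineLength_eq hπ hρ hlt).le
  · have hlt := lt_of_le_of_ne hge fun h' => h.lt.ne' (lift_injective J π h')
    have := h.symm.affineLength_eq hρ hπ (by simpa [h.lift_eq] using hlt)
    omega

theorem IsEdge.lift_lt_of_affineLength {n : ℕ} {J : Finset (Fin n)} {π ρ : Equiv.Perm (Fin n)}
    {i l : Fin n} (h : IsEdge π ρ i l) (hπ : π ∈ permSet J) (hρ : ρ ∈ permSet J)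
    (hlen : affineLength (lift J π) < affineLength (lift J ρ)) :
    lift J π i < lift J π l := by
  by_contra! hge
  have hlt := lt_of_le_of_ne hge fun h' => h.lt.ne' (lift_injective J π h')
  have := h.symm.affineLength_eq hρ hπ (by simpa [h.lift_eq] using hlt)
  omega

/-! ### Affinizations and existence of bridges -/

/-- `f` is an affinization of `π⁻¹` with any choice of the colours of the fixed points. -/
def IsAffinization {n : ℕ} (J : Finset (Fin n)) (π : Equiv.Perm (Fin n)) (f : Fin n → ℕ) : Prop :=
  ∀ v, (π v ≠ v → f v = lift J π v) ∧ (π v = v → IsFixedPos f v)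

theorem IsAffinization.isFixedPos_iff {n : ℕ} {J : Finset (Fin n)} {π : Equiv.Perm (Fin n)}
    {f : Fin n → ℕ} (hf : IsAffinization J π f) (v : Fin n) : IsFixedPos f v ↔ π v = v := by
  refine ⟨fun h => ?_, (hf v).2⟩
  by_contra hc
  refine hc (isFixedPos_lift_iff (J := J).1 ?_)
  rwa [IsFixedPos, ← (hf v).1 hc]

theorem IsAffinization.isDecoratedId_iff {n : ℕ} {J : Finset (Fin n)} {π : Equiv.Perm (Fin n)}
    {f : Fin n → ℕ} (hf : IsAffinization J π f) : IsDecoratedId f ↔ π = 1 := by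
  simp only [IsDecoratedId, hf.isFixedPos_iff, Equiv.ext_iff, Equiv.Perm.one_apply]

theorem IsAffinization.comp_swap {n : ℕ} {J : Finset (Fin n)} {π : Equiv.Perm (Fin n)}
    {f : Fin n → ℕ} (hf : IsAffinization J π f) {i l : Fin n} (hi : π i ≠ i) (hl : π l ≠ l) :
    IsAffinization J (Equiv.swap i l * π) (f ∘ Equiv.swap i l) := by
  have hmoved : ∀ v, v = i ∨ v = l →
      (f ∘ Equiv.swap i l) v = lift J (Equiv.swap i l * π) v := by
    rintro v (rfl | rfl)
    · simp [lift_swap_mul, (hf l).1 hl]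
    · simp [lift_swap_mul, (hf i).1 hi]
  intro v
  by_cases hv : v = i ∨ v = l
  · have h1 := hmoved v hv
    refine ⟨fun _ => h1, fun h => ?_⟩
    rw [IsFixedPos, h1]
    exact isFixedPos_lift_iff.2 h
  · push Not at hv
    have h1 : Equiv.swap i l v = v := Equiv.swap_apply_of_ne_of_ne hv.1 hv.2
    have h2 : (Equiv.swap i l * π) v = v ↔ π v = v := by
      rw [Equiv.Perm.mul_apply, ← Equiv.eq_symm_apply, Equiv.symm_swap, h1]
    rw [ne_eq, h2, IsFixedPos, lift_swap_mul, Function.comp_apply, Function.comp_apply, h1]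
    exact hf v

theorem IsAffinization.isBridge {n : ℕ} {J : Finset (Fin n)} {π ρ : Equiv.Perm (Fin n)}
    {f : Fin n → ℕ} (hf : IsAffinization J π f) {i l : Fin n} (h : IsEdge π ρ i l)
    (hπ : π ∈ permSet J) (hρ : ρ ∈ permSet J) (hlt : lift J π i < lift J π l) :
    IsBridge f i l := by
  obtain ⟨h1, h2⟩ := h.ne_of_lift_lt hπ hρ hlt
  refine ⟨h.lt, by rwa [hf.isFixedPos_iff], by rwa [hf.isFixedPos_iff],
    fun j h3 h4 => (hf.isFixedPos_iff j).2 (h.fixed j h3 h4).1, ?_⟩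
  rwa [(hf i).1 h1, (hf l).1 h2]

theorem IsAffinization.of_isBridge {n : ℕ} {J : Finset (Fin n)} {π : Equiv.Perm (Fin n)}
    {f : Fin n → ℕ} (hf : IsAffinization J π f) (hπ : π ∈ permSet J) {i l : Fin n}
    (hb : IsBridge f i l) :
    Equiv.swap i l * π ∈ permSet J ∧ IsEdge π (Equiv.swap i l * π) i l ∧
      lift J π i < lift J π l ∧ IsAffinization J (Equiv.swap i l * π) (f ∘ Equiv.swap i l) := by
  obtain ⟨hil, hi, hl, hbet, hlt⟩ := hb
  simp only [hf.isFixedPos_iff] at hi hl hbet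
  have hm : IsMove {v | π v = v} {v | v ∈ J} i l :=
    ⟨hil, hbet, fun h => absurd h hi, fun h => absurd h hl⟩
  refine ⟨hm.swap_mul_mem hπ, ⟨hil, rfl, fun j h1 h2 => ⟨hbet j h1 h2, ?_⟩⟩, ?_,
    hf.comp_swap hi hl⟩
  · rw [Equiv.Perm.mul_apply, hbet j h1 h2, Equiv.swap_apply_of_ne_of_ne h1.ne' h2.ne]
  · rwa [(hf i).1 hi, (hf l).1 hl] at hlt

/-- Among the non-fixed values, the smallest sits at a position outside `J` and the largest at one
in `J`. Take `l` the smallest non-fixed value at a position in `J` and `i` the non-fixed value just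
before it: then `f i < n ≤ f l`. -/
theorem IsAffinization.exists_isBridge {n : ℕ} {J : Finset (Fin n)} {π : Equiv.Perm (Fin n)}
    {f : Fin n → ℕ} (hf : IsAffinization J π f) (hπ : π ∈ permSet J) (hne : π ≠ 1) :
    ∃ i l, IsBridge f i l := by
  classical
  have hN : (univ.filter fun v => π v ≠ v).Nonempty := by
    by_contra hc
    rw [not_nonempty_iff_eq_empty, filter_eq_empty_iff] at hc
    exact hne (Equiv.ext fun v => by simpa using hc (mem_univ v))
  have hsymm : ∀ v, π v ≠ v → π (π.symm v) ≠ π.symm v ∧ π (π.symm v) = v := by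
    intro v hv
    rw [Equiv.apply_symm_apply]
    exact ⟨fun h => hv (by rw [Equiv.eq_symm_apply] at h; exact h), rfl⟩
  set N := univ.filter fun v => π v ≠ v with hNdef
  have hmemN : ∀ v, v ∈ N ↔ π v ≠ v := fun v => by simp [hNdef]
  have hsymmN : ∀ v ∈ N, π.symm v ∈ N := fun v hv =>
    (hmemN _).2 (hsymm v ((hmemN v).1 hv)).1
  have hsymmne : ∀ v ∈ N, π.symm v ≠ v := fun v hv h =>
    (hmemN v).1 hv (by rw [Equiv.symm_apply_eq] at h; exact h.symm)
  have hminJ : π.symm (N.min' hN) ∉ J := by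
    intro hJ
    have h1 := hπ.1 _ hJ
    rw [Equiv.apply_symm_apply] at h1
    exact hsymmne _ (min'_mem N hN) (le_antisymm h1 (min'_le N _ (hsymmN _ (min'_mem N hN))))
  have hmaxJ : π.symm (N.max' hN) ∈ J := by
    by_contra hJ
    have h1 := hπ.2 _ hJ
    rw [Equiv.apply_symm_apply] at h1
    exact hsymmne _ (max'_mem N hN) (le_antisymm (le_max' N _ (hsymmN _ (max'_mem N hN))) h1)
  have hA : (N.filter fun v => π.symm v ∈ J).Nonempty :=
    ⟨_, mem_filter.2 ⟨max'_mem N hN, hmaxJ⟩⟩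
  set l := (N.filter fun v => π.symm v ∈ J).min' hA with hl
  obtain ⟨hlN, hlJ⟩ := mem_filter.1 (min'_mem _ hA)
  rw [← hl] at hlN hlJ
  have hB : (N.filter fun v => v < l).Nonempty := by
    refine ⟨N.min' hN, mem_filter.2 ⟨min'_mem N hN, lt_of_le_of_ne (min'_le N _ hlN) fun h => ?_⟩⟩
    rw [h] at hminJ
    exact hminJ hlJ
  set i := (N.filter fun v => v < l).max' hB with hi
  obtain ⟨hiN, hil⟩ := mem_filter.1 (max'_mem _ hB)
  rw [← hi] at hiN hil
  have hiJ : π.symm i ∉ J := fun h =>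
    absurd (min'_le _ i (mem_filter.2 ⟨hiN, h⟩)) (not_le.2 hil)
  rw [hmemN] at hiN hlN
  refine ⟨i, l, hil, by rwa [hf.isFixedPos_iff], by rwa [hf.isFixedPos_iff], ?_, ?_⟩
  · intro j h1 h2
    rw [hf.isFixedPos_iff]
    by_contra hc
    exact absurd (le_max' _ j (mem_filter.2 ⟨(hmemN j).2 hc, h2⟩)) (not_le.2 h1)
  · rw [(hf i).1 hiN, (hf l).1 hlN, lift, lift, if_neg hiJ, if_pos hlJ]
    omega

theorem IsAffinization.exists_isBridgeSequence {n : ℕ} {J : Finset (Fin n)}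
    {π : Equiv.Perm (Fin n)} {f : Fin n → ℕ} (hf : IsAffinization J π f) (hπ : π ∈ permSet J) :
    ∃ τ, IsBridgeSequence f τ := by
  -- Each bridge raises the length, which `affineLength_le` bounds, so the construction terminates.
  induction hN : (2 * (n : ℤ) * n - affineLength (lift J π)).toNat using
    Nat.strong_induction_on generalizing π f with
  | _ N ih =>
    by_cases h1 : π = 1
    · exact ⟨[], .done f (hf.isDecoratedId_iff.2 h1)⟩
    · obtain ⟨i, l, hb⟩ := hf.exists_isBridge hπ h1
      obtain ⟨hρ, he, hlt, hf'⟩ := hf.of_isBridge hπ hb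
      have h2 := he.affineLength_eq hπ hρ hlt
      have h3 := BridgePolytope.affineLength_le (lift J (Equiv.swap i l * π))
      obtain ⟨τ, hτ⟩ := ih _ (by omega) hf' hρ rfl
      exact ⟨_, .step f i l τ hb hτ⟩

/-! ### Shortest paths and bridge decompositions -/

theorem adj_iff_exists_isEdge {n : ℕ} {J : Finset (Fin n)} {π ρ : permSet J} :
    (oneSkeleton J).Adj π ρ ↔ ∃ i l, IsEdge π.1 ρ.1 i l := by
  rw [oneSkeleton_adj_iff]
  exact ⟨fun ⟨i, l, h1, h2, h3⟩ => ⟨i, l, h1, h2, h3⟩, fun ⟨i, l, h1, h2, h3⟩ => ⟨i, l, h1, h2, h3⟩⟩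

theorem edgeLabels_cons {n : ℕ} {J : Finset (Fin n)} {π ρ θ : permSet J}
    (h : (oneSkeleton J).Adj π ρ) (p : (oneSkeleton J).Walk ρ θ) :
    edgeLabels (.cons h p) = ρ.1 * π.1⁻¹ :: edgeLabels p := rfl

theorem edgeLabels_injective {n : ℕ} {J : Finset (Fin n)} {π ρ : permSet J} :
    Function.Injective (edgeLabels (π := π) (ρ := ρ)) := by
  intro p
  induction p with
  | nil =>
    intro q h
    cases q with
    | nil => rfl
    | cons h' q => simp [edgeLabels] at h
  | @cons u v w h p ih =>
    intro q hq
    cases q with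
    | nil => simp [edgeLabels] at hq
    | @cons _ v' _ h' q =>
      rw [edgeLabels_cons, edgeLabels_cons, List.cons.injEq, mul_left_inj] at hq
      obtain ⟨h1, h2⟩ := hq
      obtain rfl : v = v' := Subtype.ext h1
      rw [ih h2]

theorem affineLength_sub_le_length {n : ℕ} {J : Finset (Fin n)} {π ρ : permSet J}
    (p : (oneSkeleton J).Walk π ρ) :
    affineLength (lift J ρ.1) - affineLength (lift J π.1) ≤ p.length := by
  induction p with
  | nil => simp
  | @cons u v w h p ih =>
    obtain ⟨i, l, he⟩ := adj_iff_exists_isEdge.1 h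
    have := he.affineLength_le u.2 v.2
    rw [SimpleGraph.Walk.length_cons]
    push_cast
    omega

theorem exists_walk_of_isBridgeSequence {n : ℕ} {J : Finset (Fin n)} {f : Fin n → ℕ}
    {τ : List (Equiv.Perm (Fin n))} (hτ : IsBridgeSequence f τ) (π : permSet J)
    (hf : IsAffinization J π.1 f) :
    ∃ p : (oneSkeleton J).Walk π (idVertex J), edgeLabels p = τ ∧
      (p.length : ℤ) = affineLength (lift J (idVertex J).1) - affineLength (lift J π.1) := by
  induction hτ generalizing π with
  | done f hd =>
    obtain rfl : π = idVertex J := Subtype.ext (hf.isDecoratedId_iff.1 hd)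
    exact ⟨.nil, rfl, by simp⟩
  | step f i l τ hb _ ih =>
    obtain ⟨hρ, he, hlt, hf'⟩ := hf.of_isBridge π.2 hb
    obtain ⟨p, hp, hlen⟩ := ih ⟨_, hρ⟩ hf'
    have h1 := he.affineLength_eq π.2 hρ hlt
    refine ⟨.cons (adj_iff_exists_isEdge.2 ⟨i, l, he⟩) p, ?_, ?_⟩
    · rw [edgeLabels_cons, hp, mul_inv_cancel_right]
    · rw [SimpleGraph.Walk.length_cons]
      push_cast
      rw [hlen]
      simp only [h1]
      ring

/-- Each edge gains at most one in length, so a walk with as many edges as the total gain must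
increase at every step, and each increasing edge is a bridge. -/
theorem isBridgeSequence_edgeLabels {n : ℕ} {J : Finset (Fin n)} {π ρ : permSet J}
    (p : (oneSkeleton J).Walk π ρ) (hρ : ρ.1 = 1)
    (hlen : (p.length : ℤ) = affineLength (lift J ρ.1) - affineLength (lift J π.1))
    {f : Fin n → ℕ} (hf : IsAffinization J π.1 f) : IsBridgeSequence f (edgeLabels p) := by
  induction p generalizing f with
  | nil => exact .done f (hf.isDecoratedId_iff.2 hρ)
  | @cons u v w h p ih =>
    obtain ⟨i, l, he⟩ := adj_iff_exists_isEdge.1 h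
    have h1 := he.affineLength_le u.2 v.2
    have h2 := affineLength_sub_le_length p
    rw [SimpleGraph.Walk.length_cons] at hlen
    push_cast at hlen
    have hlt := he.lift_lt_of_affineLength u.2 v.2 (by omega)
    have hb := hf.isBridge he u.2 v.2 hlt
    have hf' := (hf.of_isBridge u.2 hb).2.2.2
    rw [he.swap_mul] at hf'
    rw [edgeLabels_cons, ← he.swap_mul, mul_inv_cancel_right]
    exact .step f i l _ hb (ih hρ (by omega) hf')

theorem isAffinization_affinization {n : ℕ} {J : Finset (Fin n)} {π : Equiv.Perm (Fin n)}
    (hπ : π ∈ permSet J) (D : DecoratedPerm n) (hD : D.perm = π⁻¹) :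
    IsAffinization J π D.affinization := by
  have hDv : ∀ v, D.perm v = π.symm v := fun v => by rw [hD]; rfl
  intro v
  constructor
  · intro hv
    have hne : π.symm v ≠ v := fun h => hv (by rw [Equiv.symm_apply_eq] at h; exact h.symm)
    have hc : v ∉ D.ccw := fun h => hne (by rw [← hDv]; exact D.fixed_of_mem_ccw v h)
    have hiff : π.symm v < v ↔ π.symm v ∈ J := by
      constructor
      · intro h
        by_contra hJ
        have := hπ.2 _ hJ
        rw [Equiv.apply_symm_apply] at this
        exact absurd h this.not_gt
      · intro hJ
        have := hπ.1 _ hJ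
        rw [Equiv.apply_symm_apply] at this
        exact lt_of_le_of_ne this hne
    simp only [DecoratedPerm.affinization, lift, hDv, hc, or_false, hiff]
    split_ifs <;> rfl
  · intro hv
    have h : π.symm v = v := by rw [Equiv.symm_apply_eq]; exact hv.symm
    simp only [DecoratedPerm.affinization, IsFixedPos, hDv, h]
    split_ifs
    · exact Or.inr rfl
    · exact Or.inl rfl

theorem bijOn_edgeLabels {n : ℕ} (J : Finset (Fin n)) (D : DecoratedPerm n)
    (hD : D.perm = (schubertPerm J)⁻¹) :
    Set.BijOn (fun p : (oneSkeleton J).Walk (topVertex J) (idVertex J) => edgeLabels p)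
      {p | ∀ q : (oneSkeleton J).Walk (topVertex J) (idVertex J), p.length ≤ q.length}
      {τ | IsBridgeDecomposition D τ} := by
  have hf : IsAffinization J (topVertex J).1 D.affinization :=
    isAffinization_affinization (schubertPerm_mem_permSet J) D hD
  refine ⟨fun p hp => ?_, edgeLabels_injective.injOn, fun τ hτ => ?_⟩
  -- One bridge sequence gives a walk attaining the lower bound, so every shortest walk attains it.
  · obtain ⟨τ, hτ⟩ := hf.exists_isBridgeSequence (topVertex J).2
    obtain ⟨q, -, hq⟩ := exists_walk_of_isBridgeSequence hτ (topVertex J) hf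
    have h1 := affineLength_sub_le_length p
    have h2 : (p.length : ℤ) ≤ q.length := Nat.cast_le.2 (hp q)
    exact isBridgeSequence_edgeLabels p rfl (by omega) hf
  · obtain ⟨p, hp, hlen⟩ := exists_walk_of_isBridgeSequence hτ (topVertex J) hf
    refine ⟨p, fun q => ?_, hp⟩
    have := affineLength_sub_le_length q
    omega

end

end BridgePolytope

theorem theorem3p2 (n k : ℕ) (J : Finset (Fin n)) (hJ : J.card = k) :
    -- the vertices of the polytope are exactly the points labelled by the permutations in `S_J`
    Set.extremePoints ℝ (BridgePolytope.bridgePolytope J) = BridgePolytope.permPoint '' BridgePolytope.permSet J ∧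
    -- reading off edge labels is a bijection from shortest paths to bridge decompositions
    (∀ D : BridgePolytope.DecoratedPerm n, D.perm = (BridgePolytope.schubertPerm J)⁻¹ →
      Set.BijOn (fun p : (BridgePolytope.oneSkeleton J).Walk (BridgePolytope.topVertex J) (BridgePolytope.idVertex J) => BridgePolytope.edgeLabels p)
        {p | ∀ q : (BridgePolytope.oneSkeleton J).Walk (BridgePolytope.topVertex J) (BridgePolytope.idVertex J), p.length ≤ q.length}
        {τ | BridgePolytope.IsBridgeDecomposition D τ}) ∧
    -- the edges of the polytope
    (∀ π ρ : BridgePolytope.permSet J, (BridgePolytope.oneSkeleton J).Adj π ρ ↔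
      ∃ i l : Fin n, i < l ∧ Equiv.swap i l * π.1 = ρ.1 ∧
        ∀ j, i < j → j < l → π.1 j = j ∧ ρ.1 j = j) := by
  exact ⟨BridgePolytope.extremePoints_bridgePolytope J, BridgePolytope.bijOn_edgeLabels J,
    BridgePolytope.oneSkeleton_adj_iff⟩
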